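/- **Setting.** Let $E$ be a set and let $\lambda : 2^E\to\mathbb N\cup\{\infty\}$ be symmetric ($\lambda(A)=\lambda(E\setminus A)$), submodular ($\lambda(A\cup B)+\lambda(A\cap B)\le\lambda(A)+\lambda(B)$) and limit-closed (for every $n\in\mathbb N$, the union of a non-empty chain of sets of order at most $n$ has order at most $n$), where $\lambda(A)$ is called the *order* of $A$. Let $k\ge 1$ be an integer. *Profiles.* For an integer $l\ge 0$ let $S_l$ be the set of all $A\subseteq E$ of order less than $l$. A $k$-profile is a set $P\subseteq S_k$ such that (i) for every $A\in S_k$, exactly one element of $\{A,E\setminus A\}$ lies in $P$; (ii) there are no $E\setminus A\in P$ and $B\in P$ with $A\subsetneq B$ and $B\neq E\setminus A$; (iii) $E\setminus(A\cup B)\notin P$ for all $A,B\in P$. The truncation of $P$ to $S_{k-1}$ is $P\cap S_{k-1}$. A set $A$ distinguishes $P$ and $P'$ if one of them contains $A$ and the other contains $E\setminus A$. *Pseudo-flowers.* A $k$-pseudo-flower is a partition $\Phi=(P_i)_{i\in I}$ of $E$ into non-empty petals with a cyclically ordered index set $I$ such that the union of the petals of any interval of $I$ has order at most $k-1$. (An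 interval is a subset $J$ of $I$ that for any $x,y\in J$ contains one of the open intervals $]x,y[$, $]y,x[$; it is non-trivial if $\emptyset\ne J\ne I$.) The sets *displayed* by $\Phi$ are the unions of the petals of non-trivial intervals. A concatenation of $\Phi$ is a $k$-pseudo-flower $(Q_i)_{i\in I'}$ for which there is a map $f:I\to I'$ such that $P_i\subseteq Q_{f(i)}$ for all $i\in I$ and preimages of intervals are intervals. A $k$-flower is a $k$-pseudo-flower with at least four petals all of whose displayed sets have order exactly $k-1$. A $k$-anemone is a $k$-flower such that in each of its concatenations with finitely many petals all non-trivial unions of petals (neither no petal nor all petals) have order exactly $k-1$. A strong $k$-pseudo-anemone is a $k$-pseudo-flower all of whose unions of petals have order at most $k-1$. *Pre-orders.* For strong $k$-pseudo-anemones write $\Phi\le_A\Psi$ if the partition of $\Phi$ is coarser than or equal to that of $\Psi$. For a set $\mathcal P$ of $k$-profiles, write $\Phi\preccurlyeq_A\Psi$ for strong $k$-pseudo-anemones if any two profiles in $\mathcal P$ distinguished by a union of petals of $\Phi$ are distinguished by a union of petals of $\Psi$; and write $\Phi\preccurlyeq\Psi$ for $k$-pseudo-flowers if any two profiles in $\mathcal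 P$ distinguished by the union of an interval of $\Phi$ are distinguished by the union of an interval of $\Psi$. An element $\Phi$ is maximal in a pre-order $\sqsubseteq$ if $\Phi\sqsubseteq\Psi$ implies $\Psi\sqsubseteq\Phi$. **Statement.** 1. Let $\mathcal P$ be a set of $k$-profiles that all have the same truncation to $S_{k-1}$. Let $\Phi$ be a $\le_A$-maximal strong $k$-pseudo-anemone that has a concatenation into a $k$-anemone, and suppose that some three elements of $\mathcal P$ are pairwise distinguished by sets displayed by $\Phi$. Then $\Phi$ is $\preccurlyeq_A$-maximal among the strong $k$-pseudo-anemones. 2. In contrast, $\preccurlyeq$-maximal anemones need not exist: let $E$ be any infinite set, $k\ge 2$, let $\lambda(\emptyset)=\lambda(E)=0$ and $\lambda(A)=k-1$ for all other $A\subseteq E$, and let $\mathcal P$ be the set of all $k$-profiles. Then $\lambda$ is symmetric, submodular and limit-closed, all elements of $\mathcal P$ have the same truncation to $S_{k-1}$, there is a $k$-anemone, but no $k$-anemone is $\preccurlyeq$-maximal among the $k$-anemones, and no $k$-pseudo-flower is $\preccurlyeq$-maximal among the $k$-pseudo-flowers. -/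

import Mathlib

universe u

/-- `lam` is the connectivity function of a connectivity system on the ground set `E`:
symmetric, submodular and limit-closed. -/
structure IsConnectivity {E : Type u} (lam : Set E → ℕ∞) : Prop where
  symm : ∀ A : Set E, lam Aᶜ = lam A
  submodular : ∀ A B : Set E, lam (A ∪ B) + lam (A ∩ B) ≤ lam A + lam B
  limit_closed : ∀ (n : ℕ) (C : Set (Set E)), C.Nonempty → IsChain (· ⊆ ·) C →
    (∀ A ∈ C, lam A ≤ (n : ℕ∞)) → lam (⋃₀ C) ≤ (n : ℕ∞)

/-! ### Profiles -/

/-- The separation system `S_k` of all sets of order less than `k`. The inverse of a separation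
`A` is its complement, the order relation is inclusion, and joins are unions. -/
def sepSystem {E : Type u} (lam : Set E → ℕ∞) (k : ℕ) : Set (Set E) :=
  {A | lam A < (k : ℕ∞)}

/-- `O` is an orientation of `S`: a subset of `S` containing exactly one of `A`, `Aᶜ` for every
`A` in `S`. -/
def IsOrientation {E : Type u} (S O : Set (Set E)) : Prop :=
  O ⊆ S ∧ ∀ A ∈ S, ∃! B : Set E, B ∈ O ∩ {A, Aᶜ}

/-- `O` does not contain `Aᶜ` and `B` which are not orientations of each other with `A ⊂ B`. -/
def IsConsistent {E : Type u} (O : Set (Set E)) : Prop :=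
  ¬ ∃ A B : Set E, Aᶜ ∈ O ∧ B ∈ O ∧ B ≠ A ∧ B ≠ Aᶜ ∧ A ⊂ B

/-- `P` is a `k`-profile: a consistent orientation of `S_k` with the profile property. -/
def IsProfile {E : Type u} (lam : Set E → ℕ∞) (k : ℕ) (P : Set (Set E)) : Prop :=
  IsOrientation (sepSystem lam k) P ∧ IsConsistent P ∧
    ∀ A ∈ P, ∀ B ∈ P, (A ∪ B)ᶜ ∉ P

/-- The truncation of a profile to an `l`-profile. -/
def truncation {E : Type u} (lam : Set E → ℕ∞) (l : ℕ) (P : Set (Set E)) : Set (Set E) :=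
  P ∩ sepSystem lam l

/-- The separation `A` distinguishes `P` and `Q`: they contain distinct orientations of it. -/
def Distinguishes {E : Type u} (A : Set E) (P Q : Set (Set E)) : Prop :=
  (A ∈ P ∧ Aᶜ ∈ Q) ∨ (Aᶜ ∈ P ∧ A ∈ Q)

/-! ### Cyclically ordered partitions -/

/-- An interval of a cyclically ordered set: a subset that contains, for any two of its elements,
one of the two open intervals between them. The empty set and the whole set are the trivial
intervals. Intervals need not have end points in the cyclically ordered set. -/
def IsCyclicInterval {I : Type u} [CircularOrder I] (J : Set I) : Prop :=
  ∀ x ∈ J, ∀ y ∈ J, Set.cIoo x y ⊆ J ∨ Set.cIoo y x ⊆ J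

/-- A partition of `E` into non-empty petals whose index set is cyclically ordered. As the petals
are non-empty and disjoint, index sets in the universe of `E` suffice. -/
structure CyclicPartition (E : Type u) where
  Idx : Type u
  circ : CircularOrder Idx
  petal : Idx → Set E
  petal_nonempty : ∀ i, (petal i).Nonempty
  petal_disjoint : ∀ i j, i ≠ j → Disjoint (petal i) (petal j)
  petal_cover : ⋃ i, petal i = Set.univ

attribute [instance] CyclicPartition.circ

namespace CyclicPartition

/-- The union `S(J)` of the petals with index in `J`. -/
def unionOf {E : Type u} (Φ : CyclicPartition E) (J : Set Φ.Idx) : Set E :=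
  ⋃ i ∈ J, Φ.petal i

/-- `Φ` is a concatenation of `Ψ`, that is `Φ ≤ Ψ`. -/
def IsConcatenationOf {E : Type u} (Φ Ψ : CyclicPartition E) : Prop :=
  ∃ f : Ψ.Idx → Φ.Idx, (∀ i, Ψ.petal i ⊆ Φ.petal (f i)) ∧
    ∀ J : Set Φ.Idx, IsCyclicInterval J → IsCyclicInterval (f ⁻¹' J)

/-- `Φ ≤_A Ψ`: the partition of `Φ` is coarser than (or equal to) the partition of `Ψ`. -/
def LeA {E : Type u} (Φ Ψ : CyclicPartition E) : Prop :=
  ∀ j : Ψ.Idx, ∃ i : Φ.Idx, Ψ.petal j ⊆ Φ.petal i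

/-- All unions of intervals of petals have order at most `k - 1`. -/
def IsPseudoFlower {E : Type u} (lam : Set E → ℕ∞) (k : ℕ) (Φ : CyclicPartition E) : Prop :=
  ∀ J : Set Φ.Idx, IsCyclicInterval J → lam (Φ.unionOf J) < (k : ℕ∞)

/-- A `k`-flower: a `k`-pseudo-flower with at least four petals in which the union of any
non-trivial interval of petals has order exactly `k - 1`. -/
def IsFlower {E : Type u} (lam : Set E → ℕ∞) (k : ℕ) (Φ : CyclicPartition E) : Prop :=
  Φ.IsPseudoFlower lam k ∧ 4 ≤ ENat.card Φ.Idx ∧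
    ∀ J : Set Φ.Idx, IsCyclicInterval J → J.Nonempty → J ≠ Set.univ →
      lam (Φ.unionOf J) + 1 = (k : ℕ∞)

/-- A `k`-anemone: a `k`-flower such that all non-trivial unions of petals of its finite
concatenations have order exactly `k - 1`. -/
def IsAnemone {E : Type u} (lam : Set E → ℕ∞) (k : ℕ) (Φ : CyclicPartition E) : Prop :=
  Φ.IsFlower lam k ∧
    ∀ Ψ : CyclicPartition E, Ψ.IsPseudoFlower lam k → Ψ.IsConcatenationOf Φ → Finite Ψ.Idx →
      ∀ J : Set Ψ.Idx, J.Nonempty → J ≠ Set.univ → lam (Ψ.unionOf J) + 1 = (k : ℕ∞)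

/-- A strong `k`-pseudo-anemone: a `k`-pseudo-flower all of whose unions of petals have order
at most `k - 1`. -/
def IsStrongPseudoAnemone {E : Type u} (lam : Set E → ℕ∞) (k : ℕ) (Φ : CyclicPartition E) :
    Prop :=
  Φ.IsPseudoFlower lam k ∧ ∀ J : Set Φ.Idx, lam (Φ.unionOf J) < (k : ℕ∞)

/-- At least `n` elements of `Prf` are pairwise distinguished by separations displayed by `Φ`,
that is by unions of non-trivial intervals of petals. -/
def DistinguishesAtLeast {E : Type u} (Prf : Set (Set (Set E))) (n : ℕ) (Φ : CyclicPartition E) :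
    Prop :=
  ∃ p : Fin n → Set (Set E), (∀ a, p a ∈ Prf) ∧ ∀ a b, a ≠ b →
    ∃ J : Set Φ.Idx, IsCyclicInterval J ∧ J.Nonempty ∧ J ≠ Set.univ ∧
      Distinguishes (Φ.unionOf J) (p a) (p b)

/-- `Φ ≼ Ψ`: any two profiles in `Prf` distinguished by the union of an interval of `Φ` are also
distinguished by the union of an interval of `Ψ`. -/
def Prec {E : Type u} (Prf : Set (Set (Set E))) (Φ Ψ : CyclicPartition E) : Prop :=
  ∀ P ∈ Prf, ∀ Q ∈ Prf,
    (∃ J : Set Φ.Idx, IsCyclicInterval J ∧ Distinguishes (Φ.unionOf J) P Q) →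
      ∃ J : Set Ψ.Idx, IsCyclicInterval J ∧ Distinguishes (Ψ.unionOf J) P Q

/-- `Φ ≼_A Ψ`: any two profiles in `Prf` distinguished by a union of petals of `Φ` are also
distinguished by a union of petals of `Ψ`. -/
def PrecA {E : Type u} (Prf : Set (Set (Set E))) (Φ Ψ : CyclicPartition E) : Prop :=
  ∀ P ∈ Prf, ∀ Q ∈ Prf,
    (∃ J : Set Φ.Idx, Distinguishes (Φ.unionOf J) P Q) →
      ∃ J : Set Ψ.Idx, Distinguishes (Ψ.unionOf J) P Q

end CyclicPartition

/-- `x` is a maximal element, with respect to the pre-order `r`, of the class of objects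
satisfying `p`. -/
def IsMaximalIn {α : Type*} (p : α → Prop) (r : α → α → Prop) (x : α) : Prop :=
  p x ∧ ∀ y, p y → r x y → r y x

open Classical in
/-- The function on the subsets of `E` that is `0` on the empty set and on `E`, and `k - 1` on all
other sets. -/
noncomputable def trivialConnectivity (E : Type u) (k : ℕ) (A : Set E) : ℕ∞ :=
  if A = ∅ ∨ A = Set.univ then 0 else ((k - 1 : ℕ) : ℕ∞)

/-!
For the first part, let `g` send a point of `E` to the index of its petal in `Φ`. A profile pushes
forward along `g` to an ultrafilter on the index set, and the unions of petals of `Φ` distinguish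
two profiles exactly if these ultrafilters differ. Suppose that `p` and `q` have the same
ultrafilter with respect to `Φ`, but are distinguished by some `Ψ` with `Φ ≼_A Ψ`. Among the three
given profiles there are two, `p₁` and `p₂`, whose ultrafilters differ from each other and from that
of `p`. The profiles agree below order `k - 1`, so submodularity allows separations to be uncrossed
in their presence. Applied to unions of petals of `Ψ` that separate `p, p₁` from `q, p₂` and
`p, p₂` from `q, p₁`, this yields a set `R` such that splitting a petal of `Φ` along `R` leaves all
unions of petals of order less than `k`. Such a split contradicts `≤_A`-maximality.

For the second part, the profiles are the complements of the ultrafilters on `E`. Cut the cyclic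
order of `Φ` open to a linear order of `E` in which all unions of intervals of petals are convex up
to complementation, and, reversing it if necessary, take a strictly increasing sequence `x` in it.
Move the points `x (2 * n)` behind the rest of the initial segment generated by `x`, and let `Ψ` be
the partition into singletons with the new order. Each old initial segment differs from a new one
in finitely many points only, so `Ψ` separates all ultrafilters that `Φ` separates. In addition,
`Ψ` separates the non-principal ultrafilters on the even terms of `x` from those on the odd terms,
which convex sets never do.
-/

/-! ### Regular profiles -/

/-- The axioms of a profile `P` of a separation system `S`, with the regularity condition that
`P` is closed under taking subsets in `S`. The members of `P` are thought of as the small sets. -/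
structure IsRegularProfile {E : Type*} (S P : Set (Set E)) : Prop where
  subset : P ⊆ S
  compl_mem : ∀ A ∈ S, Aᶜ ∈ S
  compl_mem_iff : ∀ A ∈ S, (Aᶜ ∈ P ↔ A ∉ P)
  mem_of_subset : ∀ A ∈ S, ∀ B ∈ P, A ⊆ B → A ∈ P
  union_mem : ∀ A ∈ P, ∀ B ∈ P, A ∪ B ∈ S → A ∪ B ∈ P

theorem IsOrientation.compl_mem_iff {E : Type u} [Nonempty E] {S O : Set (Set E)}
    (hO : IsOrientation S O) {A : Set E} (hA : A ∈ S) : Aᶜ ∈ O ↔ A ∉ O := by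
  obtain ⟨B, ⟨hBO, hB⟩, hBu⟩ := hO.2 A hA
  refine ⟨fun hA' hAO => ?_, fun hAO => ?_⟩
  · exact compl_ne_self ((hBu Aᶜ ⟨hA', Or.inr rfl⟩).trans (hBu A ⟨hAO, Or.inl rfl⟩).symm)
  · rcases hB with rfl | rfl
    exacts [absurd hBO hAO, hBO]

theorem IsConsistent.univ_notMem {E : Type u} {O : Set (Set E)} (hO : IsConsistent O) {X : Set E}
    (hX : X ∈ O) (hne : X.Nonempty) (huniv : X ≠ Set.univ) : Set.univ ∉ O := fun h =>
  hO ⟨Xᶜ, Set.univ, by rwa [compl_compl], h, fun h => hne.ne_empty (Set.compl_univ_iff.1 h.symm),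
    by simpa using huniv.symm, Set.ssubset_univ_iff.2 (by simpa using hne.ne_empty)⟩

theorem IsConsistent.mem_of_subset {E : Type u} {S O : Set (Set E)} (hO : IsConsistent O)
    (hO' : IsOrientation S O) (huniv : Set.univ ∉ O) {A B : Set E} (hA : A ∈ S) (hB : B ∈ O)
    (hAB : A ⊆ B) : A ∈ O := by
  have : Nonempty E := by
    by_contra hE
    rw [not_nonempty_iff] at hE
    exact huniv (Subsingleton.elim B Set.univ ▸ hB)
  by_contra hAO
  have hne : B ≠ A := fun h => hAO (h ▸ hB)
  refine hO ⟨A, B, (hO'.compl_mem_iff hA).2 hAO, hB, hne, ?_, hAB.ssubset_of_ne hne.symm⟩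
  rintro rfl
  have hA' : A = ∅ := le_compl_self.1 hAB
  exact huniv (by simpa [hA'] using hB)

theorem IsProfile.isRegularProfile {E : Type u} {lam : Set E → ℕ∞} {k : ℕ} {P : Set (Set E)}
    (hP : IsProfile lam k P) (hlam : ∀ A, lam Aᶜ = lam A) {X : Set E} (hX : X ∈ sepSystem lam k)
    (hne : X.Nonempty) (hX' : X ≠ Set.univ) : IsRegularProfile (sepSystem lam k) P := by
  obtain ⟨hor, hcons, hunion⟩ := hP
  have : Nonempty E := hne.to_type
  have huniv : Set.univ ∉ P := by
    by_cases hXP : X ∈ P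
    · exact hcons.univ_notMem hXP hne hX'
    · exact hcons.univ_notMem ((hor.compl_mem_iff hX).2 hXP) (Set.nonempty_compl.2 hX')
        (by simpa using hne.ne_empty)
  exact {
    subset := hor.1
    compl_mem := fun A hA => by rwa [sepSystem, Set.mem_ofPred_eq, hlam]
    compl_mem_iff := fun A => hor.compl_mem_iff
    mem_of_subset := fun A hA B => hcons.mem_of_subset hor huniv hA
    union_mem := fun A hA B hB hAB =>
      by_contra fun h => hunion A hA B hB ((hor.compl_mem_iff hAB).2 h) }

namespace IsRegularProfile

variable {E I : Type*} {S P Q : Set (Set E)} {A B : Set E} {g : E → I}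

theorem union_mem_iff (hP : IsRegularProfile S P) (hA : A ∈ S) (hB : B ∈ S) (hAB : A ∪ B ∈ S) :
    A ∪ B ∈ P ↔ A ∈ P ∧ B ∈ P :=
  ⟨fun h => ⟨hP.mem_of_subset A hA _ h Set.subset_union_left,
    hP.mem_of_subset B hB _ h Set.subset_union_right⟩, fun h => hP.union_mem A h.1 B h.2 hAB⟩

theorem inter_mem_iff (hP : IsRegularProfile S P) (hA : A ∈ S) (hB : B ∈ S) (hAB : A ∩ B ∈ S) :
    A ∩ B ∈ P ↔ A ∈ P ∨ B ∈ P := by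
  have hAB' := hP.compl_mem _ hAB
  rw [← not_iff_not, ← hP.compl_mem_iff _ hAB, Set.compl_inter] at *
  rw [hP.union_mem_iff (hP.compl_mem A hA) (hP.compl_mem B hB) hAB', hP.compl_mem_iff A hA,
    hP.compl_mem_iff B hB, not_or]

theorem univ_notMem (hP : IsRegularProfile S P) : Set.univ ∉ P := fun h =>
  (hP.compl_mem_iff _ (hP.subset h)).1
    (hP.mem_of_subset _ (hP.compl_mem _ (hP.subset h)) _ h (Set.subset_univ _)) h

theorem distinguishes_iff (hP : IsRegularProfile S P) (hQ : IsRegularProfile S Q) (hA : A ∈ S) :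
    Distinguishes A P Q ↔ ¬(A ∈ P ↔ A ∈ Q) := by
  rw [Distinguishes, hP.compl_mem_iff A hA, hQ.compl_mem_iff A hA]
  tauto

/-- The push-forward of a regular profile `P` along a map `g` whose fibres have all their unions
in the separation system. It consists of the index sets whose preimage is not small. -/
def ultrafilter (hP : IsRegularProfile S P) (hg : ∀ J, g ⁻¹' J ∈ S) : Ultrafilter I :=
  Ultrafilter.ofComplNotMemIff
    { sets := {J | g ⁻¹' J ∉ P}
      univ_sets := hP.univ_notMem
      sets_of_superset := fun hJ hJK hK =>
        hJ (hP.mem_of_subset _ (hg _) _ hK (Set.preimage_mono hJK))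
      inter_sets := fun hJ hK hJK =>
        ((hP.inter_mem_iff (hg _) (hg _) (hg (_ ∩ _))).1 hJK).elim hJ hK }
    fun J => not_not.trans (hP.compl_mem_iff _ (hg J))

theorem mem_ultrafilter (hP : IsRegularProfile S P) (hg : ∀ J, g ⁻¹' J ∈ S) {J : Set I} :
    J ∈ hP.ultrafilter hg ↔ g ⁻¹' J ∉ P :=
  Iff.rfl

theorem preimage_mem_iff (hP : IsRegularProfile S P) (hg : ∀ J, g ⁻¹' J ∈ S) {J : Set I} :
    g ⁻¹' J ∈ P ↔ J ∉ hP.ultrafilter hg := by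
  rw [mem_ultrafilter, not_not]

theorem exists_distinguishes_iff (hP : IsRegularProfile S P) (hQ : IsRegularProfile S Q)
    (hg : ∀ J, g ⁻¹' J ∈ S) :
    (∃ J, Distinguishes (g ⁻¹' J) P Q) ↔ hP.ultrafilter hg ≠ hQ.ultrafilter hg := by
  simp only [hP.distinguishes_iff hQ (hg _), hP.preimage_mem_iff hg, hQ.preimage_mem_iff hg,
    not_iff_not, ne_eq, Ultrafilter.ext_iff, not_forall]

end IsRegularProfile

/-! ### Uncrossing -/

/-- A set of regular profiles of `S` that satisfies the conclusion of the submodularity argument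
for profiles with the same truncation: two small sets of one profile that are not both small in
another profile have their intersection in `S`. -/
structure IsUncrossingFamily {E : Type*} (S : Set (Set E)) (Prf : Set (Set (Set E))) : Prop where
  regular : ∀ P ∈ Prf, IsRegularProfile S P
  inter_mem : ∀ P ∈ Prf, ∀ Q ∈ Prf, ∀ A ∈ P, ∀ B ∈ P, A ∉ Q ∨ B ∉ Q → A ∩ B ∈ S

theorem isUncrossingFamily_sepSystem {E : Type u} {lam : Set E → ℕ∞}
    (hsubmod : ∀ A B, lam (A ∪ B) + lam (A ∩ B) ≤ lam A + lam B) {k : ℕ}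
    {Prf : Set (Set (Set E))} (hPrf : ∀ P ∈ Prf, IsRegularProfile (sepSystem lam k) P)
    (htrunc : ∀ P ∈ Prf, ∀ Q ∈ Prf, truncation lam (k - 1) P = truncation lam (k - 1) Q) :
    IsUncrossingFamily (sepSystem lam k) Prf where
  regular := hPrf
  inter_mem P hP Q hQ A hA B hB hAB := by
    have hAS : lam A < k := (hPrf P hP).subset hA
    have hBS : lam B < k := (hPrf P hP).subset hB
    have hunion : ((k - 1 : ℕ) : ℕ∞) ≤ lam (A ∪ B) := by
      by_contra! hlt
      have hkS : A ∪ B ∈ sepSystem lam k := hlt.trans_le (by exact_mod_cast k.sub_le 1)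
      have hABP : A ∪ B ∈ truncation lam (k - 1) P := ⟨(hPrf P hP).union_mem A hA B hB hkS, hlt⟩
      rw [htrunc P hP Q hQ] at hABP
      have := ((hPrf Q hQ).union_mem_iff hAS hBS hkS).1 hABP.1
      tauto
    by_contra hd
    have hsum := (add_le_add hunion (not_lt.1 hd)).trans (hsubmod A B)
    clear hunion hd
    generalize lam A = a, lam B = b at *
    enat_to_nat
    omega

namespace IsRegularProfile

variable {E : Type*} {S p q : Set (Set E)} {A B R : Set E}

theorem union_inter_mem_and_notMem (hp : IsRegularProfile S p) (hq : IsRegularProfile S q)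
    (hB : B ∈ q) (hA : A ∈ S) (hAp : A ∉ p) (hRp : R ∉ p) (hRq : R ∈ q) (hAR : A ∩ R ∈ S)
    (hBAR : B ∪ A ∩ R ∈ S) : B ∪ A ∩ R ∈ q ∧ B ∪ A ∩ R ∉ p := by
  have hRS := hq.subset hRq
  rw [hp.union_mem_iff (hq.subset hB) hAR hBAR, hp.inter_mem_iff hA hRS hAR]
  exact ⟨hq.union_mem _ hB _ ((hq.inter_mem_iff hA hRS hAR).2 (Or.inr hRq)) hBAR,
    fun h => h.2.elim hAp hRp⟩

end IsRegularProfile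

theorem mem_of_ultrafilter_ne {I : Type*} {U₁ U₂ : Ultrafilter I} (hU : U₁ ≠ U₂) {K : Set I}
    (hK₁ : K ∈ U₁) (hK₂ : K ∈ U₂) {F : Set (Set I)} (hunion : ∀ Y ∈ F, ∀ Z ∈ F, Y ∪ Z ∈ F)
    (hinter : ∀ Y ∈ F, ∀ Z ∈ F, Y ∩ Z ∈ F) (hF : ∀ Y ⊆ K, (Y ∈ U₁ ↔ Y ∉ U₂) → Y ∈ F) :
    ∀ Y ⊆ K, Y ∈ F := by
  obtain ⟨D, hD₁, hD₂⟩ : ∃ D ∈ U₁, D ∉ U₂ := by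
    by_contra! hle
    exact hU (Ultrafilter.coe_le_coe.1 fun D hD => hle D hD).symm
  have hinter_D : ∀ {Z}, Z ∈ U₁ → (Z ∩ D ∈ U₁ ∧ Z ∩ D ∉ U₂) := fun hZ =>
    ⟨Filter.inter_mem hZ hD₁, fun h => hD₂ (Filter.mem_of_superset h Set.inter_subset_right)⟩
  have hdiff_D : ∀ {Z}, Z ∈ U₂ → (Z \ D ∉ U₁ ∧ Z \ D ∈ U₂) := fun hZ =>
    ⟨fun h => ((U₁.sdiff_mem_iff).1 h).2 hD₁, (U₂.sdiff_mem_iff).2 ⟨hZ, hD₂⟩⟩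
  intro Y hY
  by_cases hY₁ : Y ∈ U₁ <;> by_cases hY₂ : Y ∈ U₂
  · rw [← Set.inter_union_sdiff Y D]
    refine hunion _ (hF _ (Set.inter_subset_left.trans hY) ?_) _
      (hF _ (Set.sdiff_subset.trans hY) ?_)
    · exact iff_of_true (hinter_D hY₁).1 (hinter_D hY₁).2
    · exact iff_of_false (hdiff_D hY₂).1 (not_not.2 (hdiff_D hY₂).2)
  · exact hF Y hY (by tauto)
  · exact hF Y hY (by tauto)
  · have hYKD : (Y ∪ K ∩ D) ∩ (Y ∪ K \ D) = Y := by
      tauto_set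
    rw [← hYKD]
    refine hinter _ (hF _ (Set.union_subset hY Set.inter_subset_left) ?_) _
      (hF _ (Set.union_subset hY Set.sdiff_subset) ?_) <;>
    simp only [Ultrafilter.union_mem_iff, hY₁, hY₂, false_or]
    · exact iff_of_true (hinter_D hK₁).1 (hinter_D hK₁).2
    · exact iff_of_false (hdiff_D hK₂).1 (not_not.2 (hdiff_D hK₂).2)

theorem exists_mem_notMem_of_ultrafilter_ne {I : Type*} {U₁ U₂ V₁ V₂ : Ultrafilter I}
    (h₁₁ : U₁ ≠ V₁) (h₁₂ : U₁ ≠ V₂) (h₂₁ : U₂ ≠ V₁) (h₂₂ : U₂ ≠ V₂) :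
    ∃ M, (M ∈ U₁ ∧ M ∈ U₂) ∧ M ∉ V₁ ∧ M ∉ V₂ := by
  have hdisj : Disjoint ((U₁ : Filter I) ⊔ U₂) (V₁ ⊔ V₂) := by
    simp only [disjoint_sup_left, disjoint_sup_right, Ultrafilter.disjoint_iff_not_le,
      Ultrafilter.coe_le_coe]
    tauto
  obtain ⟨M, hM, N, hN, hMN⟩ := Filter.disjoint_iff.1 hdisj
  rw [Filter.mem_sup] at hM hN
  exact ⟨M, hM, fun h => Ultrafilter.compl_notMem_iff.2 h
      (Filter.mem_of_superset hN.1 hMN.subset_compl_left),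
    fun h => Ultrafilter.compl_notMem_iff.2 h
      (Filter.mem_of_superset hN.2 hMN.subset_compl_left)⟩

namespace IsUncrossingFamily

variable {E : Type*} {S : Set (Set E)} {Prf : Set (Set (Set E))} {A B R T₁ T₂ X : Set E}
  {p q p₁ p₂ : Set (Set E)}

theorem union_mem (h : IsUncrossingFamily S Prf) (hp : p ∈ Prf) (hq : q ∈ Prf) (hA : A ∈ S)
    (hB : B ∈ S) (hAp : A ∉ p) (hBp : B ∉ p) (hABq : A ∈ q ∨ B ∈ q) : A ∪ B ∈ S := by
  have hp' := h.regular p hp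
  have hq' := h.regular q hq
  have := hp'.compl_mem _ <| h.inter_mem p hp q hq Aᶜ ((hp'.compl_mem_iff A hA).2 hAp) Bᶜ
    ((hp'.compl_mem_iff B hB).2 hBp) (by
      rw [hq'.compl_mem_iff A hA, hq'.compl_mem_iff B hB]
      tauto)
  rwa [Set.compl_inter, compl_compl, compl_compl] at this

theorem union_inter_inter_mem (h : IsUncrossingFamily S Prf) (hq : q ∈ Prf) (h₁ : p₁ ∈ Prf)
    (h₂ : p₂ ∈ Prf) (hXA : Disjoint X A) (hXA' : X ∪ A ∈ S) (hAq : A ∉ q) (hA₁ : A ∈ p₁)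
    (hX₁ : X ∈ p₁) (hX₂ : X ∉ p₂) (hT₁q : T₁ ∈ q) (hT₁ : T₁ ∉ p₁)
    (hT₂q : T₂ ∈ q) (hT₂ : T₂ ∈ p₁) (hT₂' : T₂ ∉ p₂) : X ∪ A ∩ (T₁ ∩ T₂) ∈ S := by
  have rq := h.regular q hq
  have r₁ := h.regular p₁ h₁
  have hXS := r₁.subset hX₁
  have hAS := r₁.subset hA₁
  have hAcS := r₁.compl_mem A hAS
  have hAcq : Aᶜ ∈ q := (rq.compl_mem_iff A hAS).2 hAq
  have hXq : X ∈ q := rq.mem_of_subset X hXS _ hAcq hXA.subset_compl_right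
  have hXT₂ : X ∪ T₂ ∈ S :=
    h.union_mem h₂ h₁ hXS (rq.subset hT₂q) hX₂ hT₂' (Or.inl hX₁)
  have hXAT₂ : (X ∪ A) ∩ (X ∪ T₂) ∈ S :=
    h.inter_mem p₁ h₁ q hq _ (r₁.union_mem X hX₁ A hA₁ hXA') _ (r₁.union_mem X hX₁ T₂ hT₂ hXT₂)
      (Or.inl fun hmem => hAq ((rq.union_mem_iff hXS hAS hXA').1 hmem).2)
  have hXAT₂q : (X ∪ A) ∩ (X ∪ T₂) ∈ q :=
    rq.mem_of_subset _ hXAT₂ _ (rq.union_mem X hXq T₂ hT₂q hXT₂) Set.inter_subset_right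
  have hAcT₁ : Aᶜ ∪ T₁ ∈ S :=
    h.union_mem h₁ hq hAcS (rq.subset hT₁q) (fun hAc => (r₁.compl_mem_iff A hAS).1 hAc hA₁) hT₁
      (Or.inr hT₁q)
  have hfinal : (X ∪ A) ∩ (X ∪ T₂) ∩ (Aᶜ ∪ T₁) ∈ S :=
    h.inter_mem q hq p₁ h₁ _ hXAT₂q _ (rq.union_mem _ hAcq _ hT₁q hAcT₁)
      (Or.inr fun hmem => hT₁ ((r₁.union_mem_iff hAcS (rq.subset hT₁q) hAcT₁).1 hmem).2)
  convert hfinal using 1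
  ext x
  have hx : x ∈ X → x ∉ A := fun hxX => hXA.notMem_of_mem_left hxX
  simp only [Set.mem_union, Set.mem_inter_iff, Set.mem_compl_iff]
  tauto

variable {I : Type*} {g : E → I} {J Y : Set I}

theorem preimage_union_inter_mem_of_ultrafilter_ne (h : IsUncrossingFamily S Prf)
    (hg : ∀ J, g ⁻¹' J ∈ S) (hp : p ∈ Prf) (hq : q ∈ Prf) (hJq : g ⁻¹' J ∉ q)
    (hRp : g ⁻¹' J ∩ R ∉ p) (hRq : g ⁻¹' J ∩ R ∈ q) {U₁ U₂ : Ultrafilter I} (hU : U₁ ≠ U₂)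
    (hJ₁ : J ∉ U₁) (hJ₂ : J ∉ U₂)
    (hmixed : ∀ Y ⊆ Jᶜ, (Y ∈ U₁ ↔ Y ∉ U₂) → g ⁻¹' Y ∪ g ⁻¹' J ∩ R ∈ S) (hY : Y ⊆ Jᶜ) :
    g ⁻¹' Y ∪ g ⁻¹' J ∩ R ∈ S := by
  have rp := h.regular p hp
  have rq := h.regular q hq
  have hWq : ∀ Z ⊆ Jᶜ, g ⁻¹' Z ∪ g ⁻¹' J ∩ R ∈ S → g ⁻¹' Z ∪ g ⁻¹' J ∩ R ∈ q := by
    intro Z hZ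
    exact rq.union_mem _ (rq.mem_of_subset _ (hg Z) _ ((rq.compl_mem_iff _ (hg J)).2 hJq)
      (Set.preimage_mono hZ)) _ hRq
  have hWp : ∀ Z, g ⁻¹' Z ∪ g ⁻¹' J ∩ R ∉ p := fun Z hZ =>
    hRp (rp.mem_of_subset _ (rq.subset hRq) _ hZ Set.subset_union_right)
  refine (mem_of_ultrafilter_ne (F := {Z | Z ⊆ Jᶜ ∧ g ⁻¹' Z ∪ g ⁻¹' J ∩ R ∈ S}) hU
    (Ultrafilter.compl_mem_iff_notMem.2 hJ₁) (Ultrafilter.compl_mem_iff_notMem.2 hJ₂) ?_ ?_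
    (fun Z hZ hZU => ⟨hZ, hmixed Z hZ hZU⟩) Y hY).2
  · rintro Z ⟨hZ, hZS⟩ Z' ⟨hZ', hZS'⟩
    refine ⟨Set.union_subset hZ hZ', ?_⟩
    rw [Set.preimage_union, Set.union_union_distrib_right]
    exact h.union_mem hp hq hZS hZS' (hWp Z) (hWp Z') (Or.inl (hWq Z hZ hZS))
  · rintro Z ⟨hZ, hZS⟩ Z' ⟨hZ', hZS'⟩
    refine ⟨Set.inter_subset_left.trans hZ, ?_⟩
    rw [Set.preimage_inter, Set.inter_union_distrib_right]
    exact h.inter_mem q hq p hp _ (hWq Z hZ hZS) _ (hWq Z' hZ' hZS') (Or.inl (hWp Z))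

theorem preimage_union_inter_mem_of_subset (h : IsUncrossingFamily S Prf)
    (hg : ∀ J, g ⁻¹' J ∈ S) (hp : p ∈ Prf) (hq : q ∈ Prf)
    (hpq : (h.regular p hp).ultrafilter hg = (h.regular q hq).ultrafilter hg) {J₀ : Set I}
    (hJ₀ : g ⁻¹' J₀ ∉ p) (hRp : R ∉ p) (hRq : R ∈ q)
    (hW : ∀ J Y, J ⊆ J₀ → Y ⊆ Jᶜ → g ⁻¹' J ∉ p → g ⁻¹' Y ∪ g ⁻¹' J ∩ R ∈ S)
    (hJ : J ⊆ J₀) (hY : Y ⊆ Jᶜ) : g ⁻¹' Y ∪ g ⁻¹' J ∩ R ∈ S := by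
  have rp := h.regular p hp
  have rq := h.regular q hq
  have hpq' : ∀ Z, g ⁻¹' Z ∈ p ↔ g ⁻¹' Z ∈ q := fun Z => by
    rw [rp.preimage_mem_iff hg, rq.preimage_mem_iff hg, hpq]
  have hWpq : ∀ J Y, J ⊆ J₀ → Y ⊆ Jᶜ → g ⁻¹' J ∉ p → g ⁻¹' Y ∈ p →
      g ⁻¹' Y ∪ g ⁻¹' J ∩ R ∈ q ∧ g ⁻¹' Y ∪ g ⁻¹' J ∩ R ∉ p := fun J Y hJ hY hJp hYp =>
    rp.union_inter_mem_and_notMem rq ((hpq' Y).1 hYp) (hg J) hJp hRp hRq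
      (by simpa using hW J ∅ hJ (Set.empty_subset _) hJp) (hW J Y hJ hY hJp)
  by_cases hJp : g ⁻¹' J ∈ p
  swap
  · exact hW J Y hJ hY hJp
  rw [rp.preimage_mem_iff hg, not_not] at hJ₀
  by_cases hYp : g ⁻¹' Y ∈ p
  · have hbig : g ⁻¹' (J₀ \ Y) ∉ p := (rp.mem_ultrafilter hg).1 <|
      (Ultrafilter.sdiff_mem_iff _).2 ⟨hJ₀, (rp.preimage_mem_iff hg).1 hYp⟩
    obtain ⟨hWq, hWp⟩ := hWpq (J₀ \ Y) Y Set.sdiff_subset (by tauto_set) hbig hYp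
    have hYJq : g ⁻¹' (Y ∪ J) ∈ q :=
      rq.union_mem _ ((hpq' Y).1 hYp) _ ((hpq' J).1 hJp) (hg (Y ∪ J))
    have hWS := h.inter_mem q hq p hp _ hWq _ hYJq (Or.inl hWp)
    convert hWS using 1
    have hpre : g ⁻¹' J ⊆ g ⁻¹' J₀ ∧ g ⁻¹' Y ⊆ (g ⁻¹' J)ᶜ :=
      ⟨Set.preimage_mono hJ, Set.preimage_mono hY⟩
    rw [Set.preimage_union, Set.preimage_sdiff]
    tauto_set
  · have hbig : g ⁻¹' (J₀ ∩ (Y ∪ J)) ∉ p := (rp.mem_ultrafilter hg).1 <|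
      Filter.inter_mem hJ₀ <| Ultrafilter.union_mem_iff.2 <| Or.inl <|
        (rp.mem_ultrafilter hg).2 hYp
    have hsmall : g ⁻¹' (Y \ J₀) ∈ p := by
      rw [rp.preimage_mem_iff hg, Ultrafilter.sdiff_mem_iff]
      exact fun h => h.2 hJ₀
    obtain ⟨hWq, hWp⟩ := hWpq _ (Y \ J₀) Set.inter_subset_left (by tauto_set) hbig hsmall
    have hWS := h.union_mem hp hq (rq.subset hWq) (hg Y) hWp hYp (Or.inl hWq)
    convert hWS using 1
    have hpre : g ⁻¹' J ⊆ g ⁻¹' J₀ := Set.preimage_mono hJ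
    rw [Set.preimage_inter, Set.preimage_union, Set.preimage_sdiff]
    tauto_set

theorem preimage_union_preimage_inter_mem (h : IsUncrossingFamily S Prf)
    (hg : ∀ J, g ⁻¹' J ∈ S) (hp : p ∈ Prf) (hq : q ∈ Prf) (h₁ : p₁ ∈ Prf) (h₂ : p₂ ∈ Prf)
    (hne : (h.regular p₁ h₁).ultrafilter hg ≠ (h.regular p₂ h₂).ultrafilter hg)
    (hJp : g ⁻¹' J ∉ p) (hJq : g ⁻¹' J ∉ q) (hJ₁ : g ⁻¹' J ∈ p₁) (hJ₂ : g ⁻¹' J ∈ p₂)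
    (hT₁q : T₁ ∈ q) (hT₁p : T₁ ∉ p) (hT₁₁ : T₁ ∉ p₁) (hT₁₂ : T₁ ∈ p₂)
    (hT₂q : T₂ ∈ q) (hT₂p : T₂ ∉ p) (hT₂₁ : T₂ ∈ p₁) (hT₂₂ : T₂ ∉ p₂) (hY : Y ⊆ Jᶜ) :
    g ⁻¹' Y ∪ g ⁻¹' J ∩ (T₁ ∩ T₂) ∈ S := by
  have rp := h.regular p hp
  have rq := h.regular q hq
  have r₁ := h.regular p₁ h₁
  have r₂ := h.regular p₂ h₂
  have hT₁S := rq.subset hT₁q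
  have hT₂S := rq.subset hT₂q
  have hTS : T₁ ∩ T₂ ∈ S := h.inter_mem q hq p hp _ hT₁q _ hT₂q (Or.inl hT₁p)
  have hTp : T₁ ∩ T₂ ∉ p := fun h => ((rp.inter_mem_iff hT₁S hT₂S hTS).1 h).elim hT₁p hT₂p
  have hTq : T₁ ∩ T₂ ∈ q := (rq.inter_mem_iff hT₁S hT₂S hTS).2 (Or.inl hT₁q)
  have hT₁ : T₁ ∩ T₂ ∈ p₁ := (r₁.inter_mem_iff hT₁S hT₂S hTS).2 (Or.inr hT₂₁)
  have hJTS : g ⁻¹' J ∩ (T₁ ∩ T₂) ∈ S := h.inter_mem p₁ h₁ q hq _ hJ₁ _ hT₁ (Or.inl hJq)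
  refine h.preimage_union_inter_mem_of_ultrafilter_ne hg hp hq hJq
    (fun hmem => ((rp.inter_mem_iff (hg J) hTS hJTS).1 hmem).elim hJp hTp)
    ((rq.inter_mem_iff (hg J) hTS hJTS).2 (Or.inr hTq)) hne
    ((r₁.preimage_mem_iff hg).1 hJ₁) ((r₂.preimage_mem_iff hg).1 hJ₂) (fun Z hZ hZU => ?_) hY
  rw [r₁.mem_ultrafilter hg, ← r₂.preimage_mem_iff hg] at hZU
  have hdisj : Disjoint (g ⁻¹' Z) (g ⁻¹' J) :=
    (Set.disjoint_left.2 fun a ha => hZ ha).preimage g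
  by_cases hZ₁ : g ⁻¹' Z ∈ p₁
  · exact h.union_inter_inter_mem hq h₁ h₂ hdisj (hg (Z ∪ J)) hJq hJ₁ hZ₁
      (fun hZ₂ => hZU.2 hZ₂ hZ₁) hT₁q hT₁₁ hT₂q hT₂₁ hT₂₂
  · rw [Set.inter_comm T₁]
    exact h.union_inter_inter_mem hq h₂ h₁ hdisj (hg (Z ∪ J)) hJq hJ₂ (hZU.1 hZ₁) hZ₁
      hT₂q hT₂₂ hT₁q hT₁₂ hT₁₁

theorem exists_fibre_split (h : IsUncrossingFamily S Prf) (hg : ∀ J, g ⁻¹' J ∈ S)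
    (hp : p ∈ Prf) (hq : q ∈ Prf)
    (hpq : (h.regular p hp).ultrafilter hg = (h.regular q hq).ultrafilter hg)
    (hJp : g ⁻¹' J ∉ p) (hRp : R ∉ p) (hRq : R ∈ q) (hJR : g ⁻¹' J ∩ R ∈ S) :
    ∃ a ∈ J, (∃ y ∈ R, g y = a) ∧ ∃ z ∉ R, g z = a := by
  by_contra! hno
  have hpre : g ⁻¹' {a | a ∈ J ∧ ∃ y ∈ R, g y = a} = g ⁻¹' J ∩ R := by
    ext x
    refine ⟨fun ⟨hxJ, y, hy, hyx⟩ => ⟨hxJ, ?_⟩, fun ⟨hxJ, hxR⟩ => ⟨hxJ, x, hxR, rfl⟩⟩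
    by_contra hxR
    exact hno (g x) hxJ ⟨y, hy, hyx⟩ x hxR rfl
  have hmem : g ⁻¹' J ∩ R ∈ p := by
    rw [← hpre, (h.regular p hp).preimage_mem_iff hg, hpq, ← (h.regular q hq).preimage_mem_iff hg,
      hpre]
    exact (h.regular q hq).mem_of_subset _ hJR _ hRq Set.inter_subset_right
  exact (((h.regular p hp).inter_mem_iff (hg J) ((h.regular q hq).subset hRq) hJR).1 hmem).elim
    hJp hRp

theorem exists_split (h : IsUncrossingFamily S Prf) {K : Type*} {g' : E → K}
    (hg : ∀ J, g ⁻¹' J ∈ S) (hg' : ∀ M, g' ⁻¹' M ∈ S)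
    (hgg' : ∀ P (hP : P ∈ Prf) Q (hQ : Q ∈ Prf),
      (h.regular P hP).ultrafilter hg ≠ (h.regular Q hQ).ultrafilter hg →
      (h.regular P hP).ultrafilter hg' ≠ (h.regular Q hQ).ultrafilter hg')
    (hp : p ∈ Prf) (hq : q ∈ Prf) (h₁ : p₁ ∈ Prf) (h₂ : p₂ ∈ Prf)
    (hpq : (h.regular p hp).ultrafilter hg = (h.regular q hq).ultrafilter hg)
    (hpq' : (h.regular p hp).ultrafilter hg' ≠ (h.regular q hq).ultrafilter hg')
    (hp₁ : (h.regular p hp).ultrafilter hg ≠ (h.regular p₁ h₁).ultrafilter hg)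
    (hp₂ : (h.regular p hp).ultrafilter hg ≠ (h.regular p₂ h₂).ultrafilter hg)
    (h₁₂ : (h.regular p₁ h₁).ultrafilter hg ≠ (h.regular p₂ h₂).ultrafilter hg) :
    ∃ (a : I) (R : Set E), (∃ y ∈ R, g y = a) ∧ (∃ z ∉ R, g z = a) ∧
      ∀ Y, a ∉ Y → g ⁻¹' Y ∪ g ⁻¹' {a} ∩ R ∈ S := by
  obtain ⟨J₀, ⟨hJ₀, -⟩, hJ₁, hJ₂⟩ := exists_mem_notMem_of_ultrafilter_ne hp₁ hp₂ hp₁ hp₂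
  obtain ⟨M₁, ⟨hM₁p, hM₁₁⟩, hM₁q, hM₁₂⟩ := exists_mem_notMem_of_ultrafilter_ne hpq'
    (hgg' _ hp _ h₂ hp₂) (hgg' _ h₁ _ hq (hpq ▸ hp₁.symm)) (hgg' _ h₁ _ h₂ h₁₂)
  obtain ⟨M₂, ⟨hM₂p, hM₂₂⟩, hM₂q, hM₂₁⟩ := exists_mem_notMem_of_ultrafilter_ne hpq'
    (hgg' _ hp _ h₁ hp₁) (hgg' _ h₂ _ hq (hpq ▸ hp₂.symm)) (hgg' _ h₂ _ h₁ h₁₂.symm)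
  have rp := h.regular p hp
  have rq := h.regular q hq
  have hRp : g' ⁻¹' (M₁ ∩ M₂) ∉ p := (rp.mem_ultrafilter hg').1 (Filter.inter_mem hM₁p hM₂p)
  have hRq : g' ⁻¹' (M₁ ∩ M₂) ∈ q := (rq.preimage_mem_iff hg').2 fun h =>
    hM₁q (Filter.mem_of_superset h Set.inter_subset_left)
  rw [← IsRegularProfile.preimage_mem_iff] at hM₁q hM₁₂ hM₂q hM₂₁
  rw [IsRegularProfile.mem_ultrafilter] at hJ₀ hM₁p hM₁₁ hM₂p hM₂₂
  have hW : ∀ J Y, J ⊆ J₀ → Y ⊆ Jᶜ → g ⁻¹' J ∉ p →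
      g ⁻¹' Y ∪ g ⁻¹' J ∩ g' ⁻¹' (M₁ ∩ M₂) ∈ S := by
    intro J Y hJ hY hJp
    have hJq : g ⁻¹' J ∉ q := by
      rwa [← rq.mem_ultrafilter hg, ← hpq]
    have hJ_mem : ∀ P (hP : P ∈ Prf), J₀ ∉ (h.regular P hP).ultrafilter hg → g ⁻¹' J ∈ P :=
      fun P hP hJ₀P => ((h.regular P hP).preimage_mem_iff hg).2 fun hJP =>
        hJ₀P (Filter.mem_of_superset hJP hJ)
    exact h.preimage_union_preimage_inter_mem hg hp hq h₁ h₂ h₁₂ hJp hJq (hJ_mem _ h₁ hJ₁)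
      (hJ_mem _ h₂ hJ₂) hM₁q hM₁p hM₁₁ hM₁₂ hM₂q hM₂p hM₂₁ hM₂₂ hY
  obtain ⟨a, ha, hsplit₁, hsplit₂⟩ := h.exists_fibre_split hg hp hq hpq hJ₀ hRp hRq
    (by simpa using hW J₀ ∅ subset_rfl (Set.empty_subset _) hJ₀)
  exact ⟨a, g' ⁻¹' (M₁ ∩ M₂), hsplit₁, hsplit₂, fun Y hY =>
    h.preimage_union_inter_mem_of_subset hg hp hq hpq hJ₀ hRp hRq hW
      (Set.singleton_subset_iff.2 ha) (Set.subset_compl_singleton_iff.2 hY)⟩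

end IsUncrossingFamily

theorem exists_ne_ne_of_injective {α : Type*} {f : Fin 3 → α} (hf : Function.Injective f)
    (u : α) : ∃ a b, a ≠ b ∧ u ≠ f a ∧ u ≠ f b := by
  by_cases h₀ : u = f 0
  · exact ⟨1, 2, by decide, h₀ ▸ hf.ne (by decide), h₀ ▸ hf.ne (by decide)⟩
  by_cases h₁ : u = f 1
  · exact ⟨0, 2, by decide, h₀, h₁ ▸ hf.ne (by decide)⟩
  · exact ⟨0, 1, by decide, h₀, h₁⟩

section SplitFibre

variable {E I : Type*} {S : Set (Set E)} {g : E → I} {a : I} {R : Set E}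

open Classical in
/-- The refinement of `g` that splits the fibre of `a` into its parts inside `R`, where the value
is `none`, and outside `R`. -/
noncomputable def splitFibre (g : E → I) (a : I) (R : Set E) (x : E) : Option I :=
  if g x = a ∧ x ∈ R then none else some (g x)

theorem eq_of_splitFibre_eq {x y : E} (h : splitFibre g a R x = splitFibre g a R y) :
    g x = g y := by
  unfold splitFibre at h
  split_ifs at h with hx hy
  · exact hx.1.trans hy.1.symm
  · exact Option.some.inj h

theorem preimage_splitFibre_mem (hS : ∀ A ∈ S, Aᶜ ∈ S) (hg : ∀ Y, g ⁻¹' Y ∈ S)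
    (hR : ∀ Y, a ∉ Y → g ⁻¹' Y ∪ g ⁻¹' {a} ∩ R ∈ S) (M : Set (Option I)) :
    splitFibre g a R ⁻¹' M ∈ S := by
  wlog ha : some a ∉ M generalizing M
  · simpa using hS _ (this Mᶜ ha)
  by_cases hM : none ∈ M
  · convert hR (some ⁻¹' M) ha using 1
    ext x
    by_cases hx : g x = a ∧ x ∈ R
    · simp [splitFibre, hx, hM]
    · simp [splitFibre, hx]
  · convert hg (some ⁻¹' M) using 1
    ext x
    by_cases hx : g x = a ∧ x ∈ R
    · simp [splitFibre, hx, hM, ha]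
    · simp [splitFibre, hx]

end SplitFibre

/-! ### Cyclic partitions and their index maps -/

namespace CyclicPartition

variable {E : Type u} {lam : Set E → ℕ∞} {k : ℕ} {Φ : CyclicPartition E} {J : Set Φ.Idx}

theorem exists_mem_petal (Φ : CyclicPartition E) (x : E) : ∃ i, x ∈ Φ.petal i :=
  Set.mem_iUnion.1 (Φ.petal_cover ▸ Set.mem_univ x)

/-- The map sending a point of the ground set to the index of its petal. Unions of petals are the
preimages under this map. -/
noncomputable def index (Φ : CyclicPartition E) (x : E) : Φ.Idx :=
  (Φ.exists_mem_petal x).choose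

theorem index_eq_iff {x : E} {i : Φ.Idx} : Φ.index x = i ↔ x ∈ Φ.petal i := by
  have hx : x ∈ Φ.petal (Φ.index x) := (Φ.exists_mem_petal x).choose_spec
  refine ⟨fun h => h ▸ hx, fun hi => ?_⟩
  by_contra hne
  exact (Φ.petal_disjoint _ _ hne).notMem_of_mem_left hx hi

theorem unionOf_eq_preimage_index (Φ : CyclicPartition E) (J : Set Φ.Idx) :
    Φ.unionOf J = Φ.index ⁻¹' J := by
  ext x
  simp [unionOf, ← index_eq_iff]

theorem index_surjective (Φ : CyclicPartition E) : Function.Surjective Φ.index := fun i =>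
  (Φ.petal_nonempty i).imp fun _ => index_eq_iff.2

theorem unionOf_nonempty (hJ : J.Nonempty) : (Φ.unionOf J).Nonempty := by
  rw [unionOf_eq_preimage_index]
  exact hJ.preimage Φ.index_surjective

theorem unionOf_ne_univ (hJ : J ≠ Set.univ) : Φ.unionOf J ≠ Set.univ := by
  rwa [unionOf_eq_preimage_index, Ne, Set.preimage_eq_univ_iff, Φ.index_surjective.range_eq,
    Set.univ_subset_iff]

theorem leA_iff {Ψ : CyclicPartition E} :
    Φ.LeA Ψ ↔ ∀ x y, Ψ.index x = Ψ.index y → Φ.index x = Φ.index y := by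
  simp only [LeA, Set.subset_def, ← index_eq_iff]
  refine ⟨fun h x y hxy => ?_, fun h j => ?_⟩
  · obtain ⟨i, hi⟩ := h (Ψ.index x)
    rw [hi x rfl, hi y hxy.symm]
  · obtain ⟨x, rfl⟩ := Ψ.index_surjective j
    exact ⟨Φ.index x, fun y hy => h y x hy⟩

/-- The partition of `E` into the non-empty fibres of a map into a linear order, with the cyclic
order induced by the linear order. -/
def ofMap {T : Type u} [LinearOrder T] (g : E → T) : CyclicPartition E where
  Idx := Set.range g
  circ := LinearOrder.toCircularOrder (Set.range g)
  petal i := g ⁻¹' {i.1}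
  petal_nonempty := fun ⟨_, x, hx⟩ => ⟨x, hx⟩
  petal_disjoint _ _ hij := (Set.disjoint_singleton.2 (Subtype.coe_injective.ne hij)).preimage g
  petal_cover := Set.eq_univ_of_forall fun x => Set.mem_iUnion.2 ⟨⟨g x, x, rfl⟩, rfl⟩

section OfMap

variable {T : Type u} [LinearOrder T] (g : E → T)

/-- The value of `g` on a petal of `ofMap g`. -/
def ofMapVal : (ofMap g).Idx → T :=
  Subtype.val

theorem ofMapVal_injective : Function.Injective (ofMapVal g) :=
  Subtype.val_injective

theorem ofMapVal_index (x : E) : ofMapVal g ((ofMap g).index x) = g x :=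
  congrArg Subtype.val (index_eq_iff.2 rfl : (ofMap g).index x = (⟨g x, x, rfl⟩ : Set.range g))

theorem index_ofMap_eq_iff {x y : E} : (ofMap g).index x = (ofMap g).index y ↔ g x = g y := by
  rw [← (ofMapVal_injective g).eq_iff, ofMapVal_index, ofMapVal_index]

theorem unionOf_ofMapVal_preimage (M : Set T) :
    (ofMap g).unionOf (ofMapVal g ⁻¹' M) = g ⁻¹' M := by
  rw [unionOf_eq_preimage_index, ← Set.preimage_comp]
  exact congrArg (· ⁻¹' M) (funext (ofMapVal_index g))

theorem unionOf_ofMap (J : Set (ofMap g).Idx) :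
    (ofMap g).unionOf J = g ⁻¹' (ofMapVal g '' J) := by
  rw [← unionOf_ofMapVal_preimage, (ofMapVal_injective g).preimage_image]

end OfMap

theorem isStrongPseudoAnemone_ofMap {T : Type u} [LinearOrder T] {g : E → T}
    (hg : ∀ M, g ⁻¹' M ∈ sepSystem lam k) : (ofMap g).IsStrongPseudoAnemone lam k :=
  have h : ∀ J, lam ((ofMap g).unionOf J) < k := fun J => by
    rw [unionOf_ofMap]
    exact hg _
  ⟨fun J _ => h J, h⟩

theorem eq_of_isMaximalIn_leA
    (hΦ : IsMaximalIn (IsStrongPseudoAnemone lam k) LeA Φ) {T : Type u} {g : E → T}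
    (hg : ∀ M, g ⁻¹' M ∈ sepSystem lam k)
    (hgΦ : ∀ x y, g x = g y → Φ.index x = Φ.index y) {x y : E} (hxy : Φ.index x = Φ.index y) :
    g x = g y := by
  classical
  let := linearOrderOfSTO (WellOrderingRel (α := T))
  have hle : Φ.LeA (ofMap g) := leA_iff.2 fun x y hxy => hgΦ x y ((index_ofMap_eq_iff g).1 hxy)
  exact (index_ofMap_eq_iff g).1
    (leA_iff.1 (hΦ.2 _ (isStrongPseudoAnemone_ofMap hg) hle) x y hxy)

theorem mem_of_isMaximalIn_leA (hlam : ∀ A, lam Aᶜ = lam A)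
    (hΦ : IsMaximalIn (IsStrongPseudoAnemone lam k) LeA Φ) {a : Φ.Idx} {R : Set E}
    (hR : ∀ Y, a ∉ Y → Φ.index ⁻¹' Y ∪ Φ.index ⁻¹' {a} ∩ R ∈ sepSystem lam k) {x y : E}
    (hx : Φ.index x = a) (hy : Φ.index y = a) (hxR : x ∈ R) : y ∈ R := by
  have hsplit := eq_of_isMaximalIn_leA hΦ (g := splitFibre Φ.index a R)
    (fun M => preimage_splitFibre_mem
      (fun A hA => by rwa [sepSystem, Set.mem_ofPred_eq, hlam])
      (fun J => Φ.unionOf_eq_preimage_index J ▸ hΦ.1.2 J) hR M)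
    (fun x y hxy => eq_of_splitFibre_eq hxy) (hx.trans hy.symm)
  by_contra hyR
  simp [splitFibre, hx, hy, hxR, hyR] at hsplit

theorem isMaximalIn_precA_of_leA (hsymm : ∀ A, lam Aᶜ = lam A)
    (hsubmod : ∀ A B, lam (A ∪ B) + lam (A ∩ B) ≤ lam A + lam B) {Prf : Set (Set (Set E))}
    (hPrf : ∀ P ∈ Prf, IsProfile lam k P)
    (htrunc : ∀ P ∈ Prf, ∀ Q ∈ Prf, truncation lam (k - 1) P = truncation lam (k - 1) Q)
    (hΦ : IsMaximalIn (IsStrongPseudoAnemone lam k) LeA Φ)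
    (hdist : ∃ p : Fin 3 → Set (Set E), (∀ a, p a ∈ Prf) ∧ ∀ a b, a ≠ b →
      ∃ J : Set Φ.Idx, J.Nonempty ∧ J ≠ Set.univ ∧ Distinguishes (Φ.unionOf J) (p a) (p b)) :
    IsMaximalIn (IsStrongPseudoAnemone lam k) (PrecA Prf) Φ := by
  refine ⟨hΦ.1, fun Ψ hΨ hΦΨ P hP Q hQ hPQ => ?_⟩
  obtain ⟨p, hp, hpdist⟩ := hdist
  obtain ⟨J, hJ, hJ', -⟩ := hpdist 0 1 (by decide)
  have hreg : ∀ P ∈ Prf, IsRegularProfile (sepSystem lam k) P := fun P hP =>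
    (hPrf P hP).isRegularProfile hsymm (hΦ.1.2 J) (unionOf_nonempty hJ) (unionOf_ne_univ hJ')
  have hPrf' := isUncrossingFamily_sepSystem hsubmod hreg htrunc
  have hg : ∀ J, Φ.index ⁻¹' J ∈ sepSystem lam k := fun J =>
    Φ.unionOf_eq_preimage_index J ▸ hΦ.1.2 J
  have hg' : ∀ J, Ψ.index ⁻¹' J ∈ sepSystem lam k := fun J =>
    Ψ.unionOf_eq_preimage_index J ▸ hΨ.2 J
  simp only [PrecA, unionOf_eq_preimage_index] at hΦΨ hPQ hpdist ⊢
  by_contra hPQ'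
  rw [IsRegularProfile.exists_distinguishes_iff (hreg P hP) (hreg Q hQ) hg] at hPQ'
  rw [IsRegularProfile.exists_distinguishes_iff (hreg P hP) (hreg Q hQ) hg'] at hPQ
  rw [not_not] at hPQ'
  let U := fun a => (hreg _ (hp a)).ultrafilter hg
  have hU : Function.Injective U := fun a b => not_imp_not.1 fun hab =>
    ((hreg _ (hp a)).exists_distinguishes_iff (hreg _ (hp b)) hg).1
      ((hpdist a b hab).imp fun _ h => h.2.2)
  obtain ⟨a, b, hab, ha, hb⟩ := exists_ne_ne_of_injective hU ((hreg P hP).ultrafilter hg)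
  obtain ⟨c, R, ⟨y, hyR, hy⟩, ⟨z, hzR, hz⟩, hR⟩ :=
    hPrf'.exists_split hg hg' (fun P hP Q hQ h => by
      rw [← IsRegularProfile.exists_distinguishes_iff] at h ⊢
      exact hΦΨ P hP Q hQ h) hP hQ (hp a) (hp b) hPQ' hPQ ha hb (hU.ne hab)
  exact hzR (mem_of_isMaximalIn_leA hsymm hΦ hR hy hz hyR)

end CyclicPartition

/-! ### Linear orders on the ground set -/

theorem isStrictTotalOrder_sbtw {I : Type u} [CircularOrder I] (i₀ : I) :
    IsStrictTotalOrder I fun i j => (i = i₀ ∧ j ≠ i₀) ∨ sbtw i₀ i j where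
  irrefl i := by
    rintro (⟨rfl, h⟩ | h)
    exacts [h rfl, sbtw_irrefl_right h]
  trans i j l := by
    rintro (⟨rfl, hj⟩ | hij) (⟨rfl, -⟩ | hjl)
    · exact absurd rfl hj
    · exact Or.inl ⟨rfl, fun hl => sbtw_irrefl_left_right (hl ▸ hjl)⟩
    · exact absurd hij sbtw_irrefl_left_right
    · exact Or.inr (hij.cyclic_left.trans_left hjl.cyclic_left).cyclic_right
  trichotomous i j hij hji := by
    by_contra hne
    simp only [not_or, not_and, not_not] at hij hji
    have hi : i ≠ i₀ := fun h => hne (h.trans (hij.1 h).symm)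
    have hj : j ≠ i₀ := fun h => hne ((hji.1 h).trans h.symm)
    have hbtw := btw_iff_not_sbtw.2 hij.2
    rcases hbtw.antisymm (btw_iff_not_sbtw.2 hji.2).cyclic_right with h | h | h
    exacts [hne h.symm, hi h, hj h.symm]

theorem exists_linearOrder_sbtw (I : Type u) [CircularOrder I] :
    ∃ _ : LinearOrder I, ∀ a b c : I, a < b → b < c → sbtw a b c := by
  classical
  rcases isEmpty_or_nonempty I with _ | ⟨⟨i₀⟩⟩
  · exact ⟨linearOrderOfSTO (WellOrderingRel (α := I)), isEmptyElim⟩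
  have := isStrictTotalOrder_sbtw i₀
  refine ⟨linearOrderOfSTO fun i j => (i = i₀ ∧ j ≠ i₀) ∨ sbtw i₀ i j, fun a b c hab hbc => ?_⟩
  rcases hab with ⟨rfl, hb⟩ | hab <;> rcases hbc with ⟨rfl, -⟩ | hbc
  · exact absurd rfl hb
  · exact hbc
  · exact absurd hab sbtw_irrefl_left_right
  · exact (hbc.cyclic_right.trans_left hab).cyclic_left

theorem IsCyclicInterval.ordConnected_or_compl {I : Type u} [CircularOrder I] [LinearOrder I]
    (hI : ∀ a b c : I, a < b → b < c → sbtw a b c) {J : Set I} (hJ : IsCyclicInterval J) :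
    J.OrdConnected ∨ Jᶜ.OrdConnected := by
  by_contra! hno
  have exists_of_not_ordConnected : ∀ K : Set I, ¬K.OrdConnected →
      ∃ a ∈ K, ∃ b ∉ K, ∃ c ∈ K, a < b ∧ b < c := by
    intro K hK
    contrapose! hK
    exact Set.ordConnected_of_Ioo fun a ha c hc _ b hb => by_contra fun hbK =>
      (hK a ha b hbK c hc hb.1).not_gt hb.2
  obtain ⟨a, ha, b, hb, c, hc, hab, hbc⟩ := exists_of_not_ordConnected J hno.1
  obtain ⟨u, hu, v, hv, w, hw, huv, hvw⟩ := exists_of_not_ordConnected Jᶜ hno.2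
  rw [Set.notMem_compl_iff] at hv
  have hca : Set.cIoo c a ⊆ J := (hJ a ha c hc).resolve_left fun h => hb (h (hI a b c hab hbc))
  have hac := hab.trans hbc
  have hau : a < u := by
    by_contra! h
    rcases h.lt_or_eq with h | rfl
    · exact hu (hca (hI u a c h hac).cyclic_right)
    · exact hu ha
  rcases hJ a ha v hv with h | h
  · exact hu (h (hI a u v hau huv))
  · exact hw (h (hI a v w (hau.trans huv) hvw).cyclic_left)

theorem exists_linearOrder_monotone {E I : Type*} [LinearOrder I] (f : E → I) :
    ∃ _ : LinearOrder E, Monotone f := by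
  classical
  let := linearOrderOfSTO (WellOrderingRel (α := E))
  refine ⟨LinearOrder.lift' (fun x => toLex (f x, x)) fun x y h => congrArg Prod.snd h,
    fun x y h => ?_⟩
  exact Prod.Lex.monotone_fst _ _ h

namespace CyclicPartition

theorem exists_linearOrder_ordConnected {E : Type u} (Φ : CyclicPartition E) :
    ∃ _ : LinearOrder E, ∀ J : Set Φ.Idx, IsCyclicInterval J →
      (Φ.unionOf J).OrdConnected ∨ (Φ.unionOf J)ᶜ.OrdConnected := by
  obtain ⟨oI, hI⟩ := exists_linearOrder_sbtw Φ.Idx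
  obtain ⟨oE, hmono⟩ := exists_linearOrder_monotone Φ.index
  refine ⟨oE, fun J hJ => ?_⟩
  rw [unionOf_eq_preimage_index, ← Set.preimage_compl]
  exact (hJ.ordConnected_or_compl hI).imp (·.preimage_mono hmono) (·.preimage_mono hmono)

theorem exists_linearOrder_strictMono_ordConnected {E : Type u} [Infinite E]
    (Φ : CyclicPartition E) :
    ∃ (_ : LinearOrder E) (x : ℕ → E), StrictMono x ∧ ∀ J : Set Φ.Idx, IsCyclicInterval J →
      (Φ.unionOf J).OrdConnected ∨ (Φ.unionOf J)ᶜ.OrdConnected := by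
  obtain ⟨oE, hconn⟩ := Φ.exists_linearOrder_ordConnected
  obtain ⟨x, hx | hx⟩ := Infinite.exists_strictMono_or_strictAnti E
  · exact ⟨oE, x, hx, hconn⟩
  · exact ⟨inferInstanceAs (LinearOrder Eᵒᵈ), x, fun m n hmn => hx hmn, fun J hJ =>
      (hconn J hJ).imp (·.dual) (·.dual)⟩

end CyclicPartition

/-! ### Moving a subsequence to the end of a sequence -/

section Interleaving

open Filter

theorem eventuallyEq_preimage_lowerClosure {E T : Type*} [Preorder T] {g : E → T} {F D : Set E}
    (hFD : (D \ F).Finite) (h : ∀ d ∈ F, ∀ y, g y ≤ g d → y ∈ D) :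
    D =ᶠ[cofinite] g ⁻¹' (lowerClosure (g '' F) : Set T) := by
  filter_upwards [hFD.compl_mem_cofinite] with y hy
  refine propext ⟨fun hyD => ?_, fun hyF => ?_⟩
  · exact subset_lowerClosure ⟨y, by_contra fun hyF => hy ⟨hyD, hyF⟩, rfl⟩
  · obtain ⟨_, ⟨d, hd, rfl⟩, hyd⟩ := hyF
    exact h d hd y hyd

variable {E : Type u} [LinearOrder E] {x : ℕ → E} {y z : E}

open Classical in
/-- The position of the block of `y` when the initial segment generated by the sequence `x` is
split into two blocks: first its points that are not of the form `x (2 * n)`, then the points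
`x (2 * n)`. The remaining points of `E` form the third block. -/
noncomputable def block (x : ℕ → E) (y : E) : ℕ :=
  if y ∈ Set.range fun n => x (2 * n) then 1 else if ∃ n, y ≤ x n then 0 else 2

theorem block_le_one_iff : block x y ≤ 1 ↔ ∃ n, y ≤ x n := by
  unfold block
  split_ifs with h h'
  · obtain ⟨n, rfl⟩ := h
    exact iff_of_true le_rfl ⟨2 * n, le_rfl⟩
  · exact iff_of_true zero_le_one h'
  · exact iff_of_false (by decide) h'

theorem block_le_two (x : ℕ → E) (y : E) : block x y ≤ 2 := by
  unfold block
  split_ifs <;> decide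

theorem block_eq_zero_iff :
    block x y = 0 ↔ y ∉ Set.range (fun n => x (2 * n)) ∧ ∃ n, y ≤ x n := by
  unfold block
  split_ifs <;> simp [*]

/-- The embedding that orders `E` by the blocks of `x`, with the given order inside each block. -/
noncomputable def reorder (x : ℕ → E) (y : E) : ℕ ×ₗ E :=
  toLex (block x y, y)

theorem reorder_injective : Function.Injective (reorder x) := fun _ _ h =>
  congrArg Prod.snd (toLex.injective h)

theorem reorder_le_reorder_iff :
    reorder x y ≤ reorder x z ↔ block x y < block x z ∨ block x y = block x z ∧ y ≤ z :=
  Prod.Lex.toLex_le_toLex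

theorem exists_isLowerSet_eventuallyEq_preimage_reorder (hx : StrictMono x) {D : Set E}
    (hD : IsLowerSet D) :
    ∃ D' : Set (ℕ ×ₗ E), IsLowerSet D' ∧ D =ᶠ[cofinite] reorder x ⁻¹' D' := by
  by_cases hxD : ∀ n, x n ∈ D
  · refine ⟨_, (lowerClosure _).lower,
      eventuallyEq_preimage_lowerClosure (F := D) (by simp) fun d hd y hyd => ?_⟩
    rcases reorder_le_reorder_iff.1 hyd with hlt | ⟨-, hle⟩
    · obtain ⟨n, hn⟩ := block_le_one_iff.1 (Nat.le_of_lt_succ (hlt.trans_le (block_le_two x d)))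
      exact hD hn (hxD n)
    · exact hD hle hd
  · push Not at hxD
    obtain ⟨n, hn⟩ := hxD
    have hlt : ∀ y ∈ D, y < x n := fun y hy => not_le.1 fun h => hn (hD h hy)
    refine ⟨_, (lowerClosure _).lower, eventuallyEq_preimage_lowerClosure
      (F := D \ Set.range fun n => x (2 * n)) ?_ fun d hd y hyd => ?_⟩
    · refine ((Set.finite_Iio n).image x).subset ?_
      rw [Set.sdiff_sdiff_right_self]
      rintro _ ⟨hyD, m, rfl⟩
      exact ⟨2 * m, hx.lt_iff_lt.1 (hlt _ hyD), rfl⟩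
    · have hd₀ : block x d = 0 := block_eq_zero_iff.2 ⟨hd.2, n, (hlt d hd.1).le⟩
      rw [reorder_le_reorder_iff, hd₀] at hyd
      exact hD (hyd.resolve_left (Nat.not_lt_zero _)).2 hd.1

end Interleaving

/-! ### Ultrafilters separated by intervals of petals -/

section Ultrafilter

open Filter

variable {E : Type u} {U V : Ultrafilter E}

theorem mem_iff_of_eventuallyEq_cofinite (hU : ↑U ≤ (cofinite : Filter E)) {A B : Set E}
    (hAB : A =ᶠ[cofinite] B) : A ∈ U ↔ B ∈ U :=
  eventually_congr ((hAB.filter_mono hU).mono fun _ h => iff_of_eq h)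

theorem compl_mem_iff_compl_mem {A : Set E} : (Aᶜ ∈ U ↔ Aᶜ ∈ V) ↔ (A ∈ U ↔ A ∈ V) := by
  rw [Ultrafilter.compl_mem_iff_notMem, Ultrafilter.compl_mem_iff_notMem, not_iff_not]

theorem exists_isLowerSet_not_mem_iff [Preorder E] {D : Set E} (hD : D.OrdConnected)
    (hUV : ¬(D ∈ U ↔ D ∈ V)) : ∃ L, IsLowerSet L ∧ ¬(L ∈ U ↔ L ∈ V) := by
  contrapose! hUV
  have hupper := compl_mem_iff_compl_mem.1 (hUV _ (upperClosure D).upper.compl)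
  rw [← hD.upperClosure_inter_lowerClosure]
  exact inter_mem_iff.trans
    ((and_congr hupper (hUV _ (lowerClosure D).lower)).trans inter_mem_iff.symm)

theorem mem_iff_of_le_map_atTop [Preorder E] {x : ℕ → E} (hx : Monotone x)
    (hU : ↑U ≤ map x atTop) (hV : ↑V ≤ map x atTop) {A : Set E} (hA : A.OrdConnected) :
    A ∈ U ↔ A ∈ V := by
  by_cases hfreq : ∃ᶠ n in atTop, x n ∈ A
  · have hev : ∀ᶠ n in atTop, x n ∈ A := by
      obtain ⟨a, ha⟩ := hfreq.exists
      filter_upwards [eventually_ge_atTop a] with n hn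
      obtain ⟨b, hnb, hb⟩ := frequently_atTop.1 hfreq n
      exact hA.out ha hb ⟨hx hn, hx hnb⟩
    exact iff_of_true (hU hev) (hV hev)
  · have hev : Aᶜ ∈ map x atTop := not_frequently.1 hfreq
    exact iff_of_false (Ultrafilter.compl_mem_iff_notMem.1 (hU hev))
      (Ultrafilter.compl_mem_iff_notMem.1 (hV hev))

end Ultrafilter

namespace CyclicPartition

variable {E : Type u}

/-- Some union of an interval of petals lies in exactly one of the two ultrafilters. -/
def Separates (Φ : CyclicPartition E) (U V : Ultrafilter E) : Prop :=
  ∃ J : Set Φ.Idx, IsCyclicInterval J ∧ ¬(Φ.unionOf J ∈ U ↔ Φ.unionOf J ∈ V)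

theorem isCyclicInterval_ofMapVal_preimage {T : Type u} [LinearOrder T] (g : E → T) {M : Set T}
    (hM : M.OrdConnected) : IsCyclicInterval (ofMapVal g ⁻¹' M) := by
  have hIoo : ∀ i ∈ ofMapVal g ⁻¹' M, ∀ j ∈ ofMapVal g ⁻¹' M, ofMapVal g i ≤ ofMapVal g j →
      Set.cIoo i j ⊆ ofMapVal g ⁻¹' M := by
    rintro i hi j hj hij l (⟨hil, hlj⟩ | ⟨-, hji⟩ | ⟨hji, -⟩)
    · exact hM.out hi hj ⟨hil.le, hlj.le⟩
    · exact absurd hij hji.not_ge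
    · exact absurd hij hji.not_ge
  intro i hi j hj
  exact (le_total (ofMapVal g i) (ofMapVal g j)).imp (hIoo i hi j hj) (hIoo j hj i hi)

theorem separates_ofMap {T : Type u} [LinearOrder T] {g : E → T} {U V : Ultrafilter E}
    {M : Set T} (hM : M.OrdConnected) (hUV : ¬(g ⁻¹' M ∈ U ↔ g ⁻¹' M ∈ V)) :
    (ofMap g).Separates U V :=
  ⟨_, isCyclicInterval_ofMapVal_preimage g hM, by rwa [unionOf_ofMapVal_preimage]⟩

theorem separates_ofMap_pure {T : Type u} [LinearOrder T] {g : E → T} (hg : Function.Injective g)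
    {U : Ultrafilter E} {a : E} (hU : U ≠ pure a) : (ofMap g).Separates U (pure a) := by
  refine separates_ofMap (M := {g a}) Set.ordConnected_singleton ?_
  rw [← Set.image_singleton, Set.preimage_image_eq _ hg]
  exact fun h => hU (Ultrafilter.coe_le_coe.1 (Filter.le_pure_iff.2 (h.2 (Set.mem_singleton a))))

theorem Separates.symm {Φ : CyclicPartition E} {U V : Ultrafilter E} (h : Φ.Separates U V) :
    Φ.Separates V U :=
  h.imp fun _ hJ => ⟨hJ.1, fun h => hJ.2 h.symm⟩

theorem separates_ofMap_of_ordConnected [LinearOrder E] {T : Type u} [LinearOrder T] {g : E → T}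
    (hg : Function.Injective g)
    (hlower : ∀ D : Set E, IsLowerSet D →
      ∃ D' : Set T, IsLowerSet D' ∧ D =ᶠ[Filter.cofinite] g ⁻¹' D')
    {U V : Ultrafilter E} {A : Set E} (hA : A.OrdConnected) (hUV : ¬(A ∈ U ↔ A ∈ V)) :
    (ofMap g).Separates U V := by
  have hne : U ≠ V := by
    rintro rfl
    exact hUV Iff.rfl
  rcases U.le_cofinite_or_eq_pure with hU | ⟨a, rfl⟩
  · rcases V.le_cofinite_or_eq_pure with hV | ⟨a, rfl⟩
    · obtain ⟨D, hD, hDUV⟩ := exists_isLowerSet_not_mem_iff hA hUV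
      obtain ⟨D', hD', hDD'⟩ := hlower D hD
      rw [mem_iff_of_eventuallyEq_cofinite hU hDD', mem_iff_of_eventuallyEq_cofinite hV hDD']
        at hDUV
      exact separates_ofMap hD'.ordConnected hDUV
    · exact separates_ofMap_pure hg hne
  · exact (separates_ofMap_pure hg hne.symm).symm

theorem separates_ofMap_reorder [LinearOrder E] {x : ℕ → E} (hx : StrictMono x)
    {U V : Ultrafilter E} (hU : (Set.range fun n => x (2 * n + 1)) ∈ U)
    (hV : (Set.range fun n => x (2 * n)) ∈ V) : (ofMap (reorder x)).Separates U V := by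
  have hlower : IsLowerSet {t : ℕ ×ₗ E | (ofLex t).1 = 0} := fun s t hts hs =>
    Nat.le_zero.1 ((Prod.Lex.monotone_fst _ _ hts).trans_eq hs)
  refine separates_ofMap hlower.ordConnected fun h => ?_
  have hU' : reorder x ⁻¹' {t | (ofLex t).1 = 0} ∈ U := by
    refine Filter.mem_of_superset hU ?_
    rintro _ ⟨n, rfl⟩
    refine block_eq_zero_iff.2 ⟨?_, 2 * n + 1, le_rfl⟩
    rintro ⟨m, hm⟩
    have := hx.injective hm
    omega
  obtain ⟨y, hy, hy'⟩ := V.nonempty_of_mem (Filter.inter_mem (h.1 hU') hV)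
  exact (block_eq_zero_iff.1 hy).1 hy'

theorem not_separates_of_le_map_atTop [Preorder E] {Φ : CyclicPartition E}
    (hconn : ∀ J : Set Φ.Idx, IsCyclicInterval J →
      (Φ.unionOf J).OrdConnected ∨ (Φ.unionOf J)ᶜ.OrdConnected)
    {x : ℕ → E} (hx : Monotone x) {U V : Ultrafilter E} (hU : ↑U ≤ Filter.map x Filter.atTop)
    (hV : ↑V ≤ Filter.map x Filter.atTop) : ¬Φ.Separates U V := fun ⟨J, hJ, hUV⟩ =>
  hUV <| (hconn J hJ).elim (mem_iff_of_le_map_atTop hx hU hV) fun h =>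
    compl_mem_iff_compl_mem.1 (mem_iff_of_le_map_atTop hx hU hV h)

theorem exists_separates_imp_and_not [Infinite E] (Φ : CyclicPartition E) :
    ∃ Ψ : CyclicPartition E, Infinite Ψ.Idx ∧ (∀ U V, Φ.Separates U V → Ψ.Separates U V) ∧
      ∃ U V, Ψ.Separates U V ∧ ¬Φ.Separates U V := by
  obtain ⟨_, x, hx, hconn⟩ := Φ.exists_linearOrder_strictMono_ordConnected
  refine ⟨ofMap (reorder x), ?_, fun U V ⟨J, hJ, hUV⟩ => ?_, ?_⟩
  · exact Infinite.of_injective _ fun y z h => reorder_injective ((index_ofMap_eq_iff _).1 h)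
  · have hsep : ∀ A : Set E, A.OrdConnected → ¬(A ∈ U ↔ A ∈ V) →
        (ofMap (reorder x)).Separates U V := fun A => separates_ofMap_of_ordConnected
      reorder_injective fun D => exists_isLowerSet_eventuallyEq_preimage_reorder hx
    refine (hconn J hJ).elim (fun h => hsep _ h hUV) fun h => hsep _ h ?_
    rwa [compl_mem_iff_compl_mem]
  · let U : Ultrafilter E := (Filter.hyperfilter ℕ).map fun n => x (2 * n + 1)
    let V : Ultrafilter E := (Filter.hyperfilter ℕ).map fun n => x (2 * n)
    have hle : ∀ s : ℕ → ℕ, StrictMono s →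
        ↑((Filter.hyperfilter ℕ).map (x ∘ s)) ≤ Filter.map x Filter.atTop := fun s hs => by
      rw [Ultrafilter.coe_map, ← Filter.map_map]
      exact Filter.map_mono ((Filter.map_mono Nat.hyperfilter_le_atTop).trans hs.tendsto_atTop)
    have hU := hle (2 * · + 1) fun m n hmn => by dsimp only; omega
    have hV := hle (2 * ·) fun m n hmn => by dsimp only; omega
    exact ⟨U, V, separates_ofMap_reorder hx Filter.range_mem_map Filter.range_mem_map,
      not_separates_of_le_map_atTop hconn hx.monotone hU hV⟩

end CyclicPartition

/-! ### The connectivity function with only trivial values -/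

section TrivialConnectivity

variable {E : Type u} {k : ℕ} {P : Set (Set E)}

theorem trivialConnectivity_compl (A : Set E) :
    trivialConnectivity E k Aᶜ = trivialConnectivity E k A := by
  simp only [trivialConnectivity, Set.compl_empty_iff, Set.compl_univ_iff, or_comm]

theorem trivialConnectivity_of_nontrivial {A : Set E} (hA : A.Nonempty) (hA' : A ≠ Set.univ) :
    trivialConnectivity E k A = (k - 1 : ℕ) :=
  if_neg (not_or.2 ⟨hA.ne_empty, hA'⟩)

theorem trivialConnectivity_le (A : Set E) : trivialConnectivity E k A ≤ (k - 1 : ℕ) := by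
  unfold trivialConnectivity
  split_ifs
  exacts [zero_le, le_rfl]

theorem isConnectivity_trivialConnectivity (E : Type u) (k : ℕ) :
    IsConnectivity (trivialConnectivity E k) where
  symm := trivialConnectivity_compl
  submodular A B := by
    by_cases hA : A = ∅ ∨ A = Set.univ
    · rcases hA with rfl | rfl <;> simp [add_comm]
    by_cases hB : B = ∅ ∨ B = Set.univ
    · rcases hB with rfl | rfl <;> simp [add_comm]
    refine (add_le_add (trivialConnectivity_le _) (trivialConnectivity_le _)).trans_eq ?_
    simp only [trivialConnectivity, if_neg hA, if_neg hB]
  limit_closed n C _ _ hC := by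
    rcases le_or_gt (k - 1) n with hn | hn
    · exact (trivialConnectivity_le _).trans (by exact_mod_cast hn)
    have htriv : ∀ A ∈ C, A = ∅ ∨ A = Set.univ := fun A hA => by
      by_contra hne
      have hle := hC A hA
      rw [trivialConnectivity, if_neg hne] at hle
      exact hn.not_ge (by exact_mod_cast hle)
    have hunion : ⋃₀ C = ∅ ∨ ⋃₀ C = Set.univ := by
      by_cases hu : Set.univ ∈ C
      · exact Or.inr (Set.eq_univ_of_univ_subset (Set.subset_sUnion_of_mem hu))
      · exact Or.inl (Set.sUnion_eq_empty.2 fun A hA =>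
          (htriv A hA).resolve_right fun h => hu (h ▸ hA))
    exact (if_pos hunion).trans_le zero_le

theorem sepSystem_trivialConnectivity (hk : 1 < k) :
    sepSystem (trivialConnectivity E k) k = Set.univ :=
  Set.eq_univ_of_forall fun A => (trivialConnectivity_le A).trans_lt
    (by exact_mod_cast k.sub_lt (zero_lt_one.trans hk) zero_lt_one)

theorem isAnemone_trivialConnectivity (hk : 1 < k) {Φ : CyclicPartition E}
    (hΦ : 4 ≤ ENat.card Φ.Idx) : Φ.IsAnemone (trivialConnectivity E k) k := by
  have horder : ∀ (Ψ : CyclicPartition E) (J : Set Ψ.Idx), J.Nonempty → J ≠ Set.univ →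
      trivialConnectivity E k (Ψ.unionOf J) + 1 = k := fun Ψ J hJ hJ' => by
    rw [trivialConnectivity_of_nontrivial (Ψ.unionOf_nonempty hJ) (Ψ.unionOf_ne_univ hJ')]
    exact_mod_cast Nat.sub_add_cancel hk.le
  have hflower : Φ.IsPseudoFlower (trivialConnectivity E k) k := fun J _ =>
    (sepSystem_trivialConnectivity hk).ge (Set.mem_univ (Φ.unionOf J))
  exact ⟨⟨hflower, hΦ, fun J _ => horder Φ J⟩, fun Ψ _ _ _ => horder Ψ⟩

/-- The profile induced by an ultrafilter, which consists of the sets outside the ultrafilter. -/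
def ultrafilterProfile (U : Ultrafilter E) : Set (Set E) :=
  {A | A ∉ U}

theorem isProfile_ultrafilterProfile (hk : 1 < k) (U : Ultrafilter E) :
    IsProfile (trivialConnectivity E k) k (ultrafilterProfile U) := by
  rw [IsProfile, sepSystem_trivialConnectivity hk]
  refine ⟨⟨Set.subset_univ _, fun A _ => ?_⟩, ?_, fun A hA B hB hAB => ?_⟩
  · by_cases hA : A ∈ U
    · refine ⟨Aᶜ, ⟨Ultrafilter.compl_notMem_iff.2 hA, Or.inr rfl⟩, ?_⟩
      rintro B ⟨hB, rfl | rfl⟩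
      exacts [absurd hA hB, rfl]
    · refine ⟨A, ⟨hA, Or.inl rfl⟩, ?_⟩
      rintro B ⟨hB, rfl | rfl⟩
      exacts [rfl, absurd (Ultrafilter.compl_mem_iff_notMem.2 hA) hB]
  · rintro ⟨A, B, hA, hB, -, -, hAB⟩
    exact hB (Filter.mem_of_superset (Ultrafilter.compl_notMem_iff.1 hA) hAB.subset)
  · exact (Ultrafilter.union_mem_iff.1 (Ultrafilter.compl_notMem_iff.1 hAB)).elim hA hB

theorem isProfile_trivialConnectivity_iff [Nontrivial E] (hk : 1 < k) :
    IsProfile (trivialConnectivity E k) k P ↔ ∃ U, ultrafilterProfile U = P := by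
  refine ⟨fun hP => ?_, ?_⟩
  · obtain ⟨a, b, hab⟩ := exists_pair_ne E
    have hS : ∀ A, A ∈ sepSystem (trivialConnectivity E k) k := fun A =>
      (sepSystem_trivialConnectivity hk).ge (Set.mem_univ A)
    have hreg := hP.isRegularProfile trivialConnectivity_compl (hS {a})
      (Set.singleton_nonempty a) (Set.ne_univ_iff_exists_notMem _ |>.2 ⟨b, hab.symm⟩)
    exact ⟨hreg.ultrafilter (g := id) hS, Set.ext fun A => (hreg.preimage_mem_iff hS).symm⟩
  · rintro ⟨U, rfl⟩
    exact isProfile_ultrafilterProfile hk U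

theorem truncation_ultrafilterProfile (hk : 1 < k) (U : Ultrafilter E) :
    truncation (trivialConnectivity E k) (k - 1) (ultrafilterProfile U) = {∅} := by
  refine Set.Subset.antisymm (fun A hA => ?_) (Set.singleton_subset_iff.2 ⟨U.empty_notMem, ?_⟩)
  · by_contra hne
    have hA' : A ≠ Set.univ := fun h => hA.1 (h ▸ Filter.univ_mem)
    exact hA.2.ne (trivialConnectivity_of_nontrivial (Set.nonempty_iff_ne_empty.2 hne) hA')
  · have hempty : trivialConnectivity E k ∅ = 0 := if_pos (Or.inl rfl)
    exact hempty.trans_lt (by exact_mod_cast Nat.sub_pos_of_lt hk)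

theorem distinguishes_ultrafilterProfile_iff {A : Set E} {U V : Ultrafilter E} :
    Distinguishes A (ultrafilterProfile U) (ultrafilterProfile V) ↔ ¬(A ∈ U ↔ A ∈ V) := by
  simp only [Distinguishes, ultrafilterProfile, Set.mem_ofPred_eq, Ultrafilter.compl_notMem_iff]
  tauto

theorem prec_trivialConnectivity_iff [Nontrivial E] (hk : 1 < k) {Φ Ψ : CyclicPartition E} :
    Φ.Prec {P | IsProfile (trivialConnectivity E k) k P} Ψ ↔
      ∀ U V, Φ.Separates U V → Ψ.Separates U V := by
  simp only [CyclicPartition.Prec, Set.mem_ofPred_eq, isProfile_trivialConnectivity_iff hk,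
    forall_exists_index, forall_apply_eq_imp_iff, distinguishes_ultrafilterProfile_iff,
    CyclicPartition.Separates]

end TrivialConnectivity

theorem exists_isAnemone_prec_not_prec {E : Type u} [Infinite E] {k : ℕ} (hk : 1 < k)
    (Φ : CyclicPartition E) :
    ∃ Ψ : CyclicPartition E, Ψ.IsAnemone (trivialConnectivity E k) k ∧
      Φ.Prec {P | IsProfile (trivialConnectivity E k) k P} Ψ ∧
      ¬Ψ.Prec {P | IsProfile (trivialConnectivity E k) k P} Φ := by
  obtain ⟨Ψ, hΨ, hle, U, V, hUV, hUV'⟩ := Φ.exists_separates_imp_and_not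
  rw [← prec_trivialConnectivity_iff hk] at hle
  refine ⟨Ψ, isAnemone_trivialConnectivity hk ?_, hle, fun h => ?_⟩
  · exact le_top.trans_eq (ENat.card_eq_top_of_infinite).symm
  · exact hUV' ((prec_trivialConnectivity_iff hk).1 h U V hUV)

theorem mainTheorem6_general :
    (∀ (E : Type u) (lam : Set E → ℕ∞), (∀ A, lam Aᶜ = lam A) →
      (∀ A B, lam (A ∪ B) + lam (A ∩ B) ≤ lam A + lam B) →
      ∀ (k : ℕ) (Prf : Set (Set (Set E))), (∀ P ∈ Prf, IsProfile lam k P) →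
      (∀ P ∈ Prf, ∀ Q ∈ Prf, truncation lam (k - 1) P = truncation lam (k - 1) Q) →
      ∀ Φ : CyclicPartition E,
        IsMaximalIn (CyclicPartition.IsStrongPseudoAnemone lam k) CyclicPartition.LeA Φ →
        (∃ p : Fin 3 → Set (Set E), (∀ a, p a ∈ Prf) ∧ ∀ a b, a ≠ b →
          ∃ J : Set Φ.Idx, J.Nonempty ∧ J ≠ Set.univ ∧ Distinguishes (Φ.unionOf J) (p a) (p b)) →
        IsMaximalIn (CyclicPartition.IsStrongPseudoAnemone lam k) (CyclicPartition.PrecA Prf) Φ) ∧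
    (∀ (E : Type u), Infinite E → ∀ (k : ℕ), 1 < k →
      ∀ (lam : Set E → ℕ∞), lam = trivialConnectivity E k →
      ∀ (Prf : Set (Set (Set E))), Prf = {P | IsProfile lam k P} →
        IsConnectivity lam ∧
        (∀ P ∈ Prf, ∀ Q ∈ Prf, truncation lam (k - 1) P = truncation lam (k - 1) Q) ∧
        (∃ Φ : CyclicPartition E, Φ.IsAnemone lam k) ∧
        (¬ ∃ Φ : CyclicPartition E,
          IsMaximalIn (CyclicPartition.IsAnemone lam k) (CyclicPartition.Prec Prf) Φ) ∧
        (¬ ∃ Φ : CyclicPartition E,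
          IsMaximalIn (CyclicPartition.IsPseudoFlower lam k) (CyclicPartition.Prec Prf) Φ)) := by
  refine ⟨fun E lam hsymm hsubmod k Prf hPrf htrunc Φ hΦ hdist =>
    CyclicPartition.isMaximalIn_precA_of_leA hsymm hsubmod hPrf htrunc hΦ hdist, ?_⟩
  rintro E _ k hk _ rfl _ rfl
  have hprec := exists_isAnemone_prec_not_prec (E := E) hk
  refine ⟨isConnectivity_trivialConnectivity E k, fun P hP Q hQ => ?_,
    (hprec (.ofMap fun _ => PUnit.unit)).imp fun _ h => h.1, fun ⟨Φ, hΦ⟩ => ?_, fun ⟨Φ, hΦ⟩ => ?_⟩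
  · obtain ⟨U, rfl⟩ := (isProfile_trivialConnectivity_iff hk).1 hP
    obtain ⟨V, rfl⟩ := (isProfile_trivialConnectivity_iff hk).1 hQ
    rw [truncation_ultrafilterProfile hk, truncation_ultrafilterProfile hk]
  · obtain ⟨Ψ, hΨ, hΦΨ, hΨΦ⟩ := hprec Φ
    exact hΨΦ (hΦ.2 Ψ hΨ hΦΨ)
  · obtain ⟨Ψ, hΨ, hΦΨ, hΨΦ⟩ := hprec Φ
    exact hΨΦ (hΦ.2 Ψ hΨ.1.1 hΦΨ)

theorem mainTheorem6 :
    (∀ (E : Type u) (lam : Set E → ℕ∞), IsConnectivity lam →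
      ∀ (k : ℕ), 1 ≤ k →
      ∀ (Prf : Set (Set (Set E))), (∀ P ∈ Prf, IsProfile lam k P) →
      (∀ P ∈ Prf, ∀ Q ∈ Prf, truncation lam (k - 1) P = truncation lam (k - 1) Q) →
      ∀ Φ : CyclicPartition E,
        IsMaximalIn (CyclicPartition.IsStrongPseudoAnemone lam k) CyclicPartition.LeA Φ →
        (∃ Θ : CyclicPartition E, Θ.IsAnemone lam k ∧ Θ.IsConcatenationOf Φ) →
        Φ.DistinguishesAtLeast Prf 3 →
        IsMaximalIn (CyclicPartition.IsStrongPseudoAnemone lam k) (CyclicPartition.PrecA Prf) Φ) ∧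
    (∀ (E : Type u), Infinite E → ∀ (k : ℕ), 1 < k →
      ∀ (lam : Set E → ℕ∞), lam = trivialConnectivity E k →
      ∀ (Prf : Set (Set (Set E))), Prf = {P | IsProfile lam k P} →
        IsConnectivity lam ∧
        (∀ P ∈ Prf, ∀ Q ∈ Prf, truncation lam (k - 1) P = truncation lam (k - 1) Q) ∧
        (∃ Φ : CyclicPartition E, Φ.IsAnemone lam k) ∧
        (¬ ∃ Φ : CyclicPartition E,
          IsMaximalIn (CyclicPartition.IsAnemone lam k) (CyclicPartition.Prec Prf) Φ) ∧
        (¬ ∃ Φ : CyclicPartition E,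
          IsMaximalIn (CyclicPartition.IsPseudoFlower lam k) (CyclicPartition.Prec Prf) Φ)) := by
  refine mainTheorem6_general.imp_left fun h E lam hlam k _ Prf hPrf htrunc Φ hΦ _ hdist => ?_
  obtain ⟨p, hp, hpdist⟩ := hdist
  exact h E lam hlam.symm hlam.submodular k Prf hPrf htrunc Φ hΦ
    ⟨p, hp, fun a b hab => (hpdist a b hab).imp fun _ hJ => hJ.2⟩
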